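/- Consider $n$ banks with holdings $a_i>0$ of an illiquid asset and cash shortfalls $h_i>0$ ($i=1,\dots,n$), a repo rate $r\in\mathbb{R}$, and $M\ge\sum_{i=1}^n a_i$. Let $\mathcal D=\prod_{j=1}^n[0,a_j]$. Let the order book density $f:[0,M]\to(0,1]$ be strictly decreasing and twice continuously differentiable, with $f(0)=1$ and with nonpositive, nondecreasing derivative $f'$. Given liquidations $s\in\mathcal D$, the average price $\bar f_i(s)$ obtained by bank $i$ is one of the following. * VWAP (volume weighted average price): $\bar f_i(0)=1$ and $\bar f_i(s)=\dfrac{\int_0^{\sum_j s_j} f(\sigma)\,d\sigma}{\sum_j s_j}$ for $s\neq 0$. * LOB (limit order book): $\bar f_i(s)=1$ if $s_i=0$; if $s_i>0$, $$\bar f_i(s)=\frac1{s_i}\sum_{j=1}^{k}\frac1{n-(j-1)}\int_{D_{j-1}}^{D_j}f(\sigma)\,d\sigma,\qquad D_j=\sum_{l=1}^{j}(n-(l-1))\,(s_{[l]}-s_{[l-1]}),$$ where $0=:s_{[0]}\le s_{[1]}\le\dots\le s_{[n]}$ are the order statistics of $s$ and $s_i=s_{[k]}$. Fix $q$ and $\bar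 q=(\bar q_1,\dots,\bar q_n)$ with $0<q<\bar q_i\le 1$ for all $i$. In the fixed-price game, bank $i$, given the liquidations $s_{-i}$ of the other banks, chooses a liquidation as follows: if it is solvent, i.e. $h_i\le a_i\bar q_i$, it chooses a minimizer $$s_i^*(s_{-i},q,\bar q)\in\operatorname*{arg\,min}_{s_i\in[0,a_i]}\; s_i\bigl(1-\bar f_i(s_i,s_{-i})\bigr)+r\bigl(h_i-s_i\bar f_i(s_i,s_{-i})\bigr)\quad\text{s.t.}\quad \frac{h_i-a_iq}{\bar q_i-q}\le s_i\le\frac{h_i}{\bar q_i};$$ if it is insolvent, i.e. $h_i>a_i\bar q_i$ (in which case the constraints cannot be met), it liquidates everything, $s_i^*=a_i$. Then, both under the VWAP and under the LOB structure, the fixed-price game has exactly one Nash equilibrium: there is a unique $\bar s=\bar s(q,\bar q)\in\mathcal D$ such that, for every bank $i$, $\bar s_i$ is a best response $s_i^*(\bar s_{-i},q,\bar q)$. -/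

import Mathlib

namespace FireSale

noncomputable section

/-- The order book density function `f : [0, M] → (0, 1]`: it is strictly decreasing, twice
continuously differentiable, `f 0 = 1`, and its derivative is nonpositive and nondecreasing
(at the end points of `[0, M]` derivatives are one-sided; values of `f` off `[0, M]` are
irrelevant). -/
structure IsOrderBookDensity (M : ℝ) (f : ℝ → ℝ) : Prop where
  mapsTo : Set.MapsTo f (Set.Icc 0 M) (Set.Ioc 0 1)
  strictAnti : StrictAntiOn f (Set.Icc 0 M)
  contDiff : ContDiffOn ℝ 2 f (Set.Icc 0 M)
  zero : f 0 = 1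
  deriv_nonpos : ∀ x ∈ Set.Icc (0 : ℝ) M, derivWithin f (Set.Icc 0 M) x ≤ 0
  deriv_mono : MonotoneOn (derivWithin f (Set.Icc 0 M)) (Set.Icc 0 M)

/-- The set of admissible liquidations, the box `∏ j, [0, a j]`. -/
def admissible {n : ℕ} (a : Fin n → ℝ) : Set (Fin n → ℝ) :=
  Set.univ.pi fun j => Set.Icc 0 (a j)

/-- Volume weighted average price: every bank obtains the average of the density over
`[0, ∑ j, s j]`, and the price is `1` when nothing is sold. -/
def vwapPrice {n : ℕ} (f : ℝ → ℝ) (s : Fin n → ℝ) (_i : Fin n) : ℝ :=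
  if s = 0 then 1 else (∫ σ in (0 : ℝ)..(∑ j, s j), f σ) / ∑ j, s j

/-- The order statistics `s_[1] ≤ s_[2] ≤ ... ≤ s_[n]` of `s`, with the convention `s_[0] = 0`.
(Indices above `n` are never used.) -/
def orderStat {n : ℕ} (s : Fin n → ℝ) (j : ℕ) : ℝ :=
  if hj : 1 ≤ j ∧ j ≤ n then s (Tuple.sort s ⟨j - 1, by omega⟩) else 0

/-- A position `k ∈ {1, ..., n}` of bank `i` in the ordering, i.e. `s i = s_[k]`. -/
def rank {n : ℕ} (s : Fin n → ℝ) (i : Fin n) : ℕ :=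
  ((Tuple.sort s).symm i : ℕ) + 1

theorem orderStat_rank {n : ℕ} (s : Fin n → ℝ) (i : Fin n) : orderStat s (rank s i) = s i := by
  have h : 1 ≤ rank s i ∧ rank s i ≤ n := by
    have := ((Tuple.sort s).symm i).isLt
    unfold rank
    omega
  unfold orderStat
  rw [dif_pos h]
  simp [rank]

/-- The amount `∑ l = 1, ..., j, (n - (l - 1)) (s_[l] - s_[l-1])` of the book that has been
consumed by all the banks when the `j`-th smallest order is completed. -/
def bookDepth {n : ℕ} (s : Fin n → ℝ) (j : ℕ) : ℝ :=
  ∑ l ∈ Finset.Icc 1 j, ((n : ℝ) - ((l : ℝ) - 1)) * (orderStat s l - orderStat s (l - 1))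

/-- Limit order book based price. -/
def lobPrice {n : ℕ} (f : ℝ → ℝ) (s : Fin n → ℝ) (i : Fin n) : ℝ :=
  if 0 < s i then
    1 / s i * ∑ j ∈ Finset.Icc 1 (rank s i),
      1 / ((n : ℝ) - ((j : ℝ) - 1)) * ∫ σ in (bookDepth s (j - 1))..(bookDepth s j), f σ
  else 1

/-- The cost of bank `i`: realized loss from the sale plus interest, at repo rate `r`, on the part
of the shortfall `h i` that has to be borrowed. Here `F s i` is the average price obtained by
bank `i` when the liquidations are `s`. -/
def cost {n : ℕ} (F : (Fin n → ℝ) → Fin n → ℝ) (h : Fin n → ℝ) (r : ℝ) (i : Fin n)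
    (s : Fin n → ℝ) : ℝ :=
  s i * (1 - F s i) + r * (h i - s i * F s i)

/-- The feasible liquidations of bank `i` at fixed haircut value `q` and fixed prices `qbar`. -/
def feasible {n : ℕ} (a h : Fin n → ℝ) (q : ℝ) (qbar : Fin n → ℝ) (i : Fin n) : Set ℝ :=
  {x | x ∈ Set.Icc 0 (a i) ∧ x ≤ h i / qbar i ∧ (h i - a i * q) / (qbar i - q) ≤ x}

/-- The set of best responses of bank `i` to the liquidations of the other banks (the entry `s i`
is irrelevant): the minimizers of the cost over the feasible set if the bank is solvent,
i.e. `h i ≤ a i * qbar i`; an insolvent bank is forced to liquidate everything. -/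
def bestResponse {n : ℕ} (F : (Fin n → ℝ) → Fin n → ℝ) (a h : Fin n → ℝ) (r q : ℝ)
    (qbar : Fin n → ℝ) (s : Fin n → ℝ) (i : Fin n) : Set ℝ :=
  if h i ≤ a i * qbar i then
    {x | x ∈ feasible a h q qbar i ∧
      IsMinOn (fun y => cost F h r i (Function.update s i y)) (feasible a h q qbar i) x}
  else {a i}

/-- Nash equilibrium of the game with fixed haircut value `q` and fixed prices `qbar`. -/
def IsEquilibrium {n : ℕ} (F : (Fin n → ℝ) → Fin n → ℝ) (a h : Fin n → ℝ) (r q : ℝ)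
    (qbar : Fin n → ℝ) (s : Fin n → ℝ) : Prop :=
  s ∈ admissible a ∧ ∀ i, s i ∈ bestResponse F a h r q qbar s i

end

end FireSale

/-!
The revenue `s i * F s i` of a bank is an explicit integral under both price structures, and its
marginal revenue turns out to be positive and strictly decreasing in the bank's own sale.

* Under VWAP the revenue is `s i * φ S`, where `S` is the total sale and `φ S` (`average`) is the
  mean of `f` over `[0, S]`. The marginal revenue is `(1 - w) φ S + w f S` (`shareMarginal`), where
  `w = s i / S` is the share of the bank. It decreases both in `w` and in `S`.
* Under LOB the revenue is `∫ y in 0..s i, f (depth s y)`, where `depth s y = ∑ j, min (s j) y`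
  (`mul_lobPrice`). The marginal revenue is `f (depth s (s i))`.

The marginal cost is `1 - (1 + r) m`, where `m` is the marginal revenue. As a function of the bank's
own sale it is positive if `1 + r ≤ 0` and strictly increasing otherwise. In both cases it changes
sign at most once, from negative to positive, so the first-order conditions on the interval
`[lower i, upper i]` of feasible sales are necessary and sufficient (`isEquilibrium_iff_isKKT`); an
insolvent bank has a one-point interval. The signs of the marginal cost then decide the game,
without a fixed-point theorem.

* LOB, existence (`exists_isKKT_depth`): all banks sell one common level `z`, clamped to their
  intervals; `z` is chosen so that the marginal cost vanishes at the depth `∑ i, min (upper i) z`.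
* LOB, uniqueness (`isKKT_depth_unique`): compare two equilibria at the smallest entry at which
  they differ; up to this entry they consume the same part of the book.
* VWAP, existence (`exists_isKKT_share`): for a given total `S` the first-order conditions determine
  each sale, and the intermediate value theorem yields a total that is consistent with them.
* VWAP, uniqueness (`isKKT_share_unique`): if one equilibrium has the larger total, some bank has
  both a larger sale and a share that is not smaller, which contradicts the monotonicity of
  its marginal cost.
-/

namespace FireSale

noncomputable section

open Set MeasureTheory

/-! ### First-order conditions for boxes -/

/-- First-order (Karush–Kuhn–Tucker) conditions on the box `∏ i, [l i, u i]` for the game in which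
`k s i` is the marginal cost of player `i` at the profile `s`. -/
def IsKKT {ι : Type*} (l u : ι → ℝ) (k : (ι → ℝ) → ι → ℝ) (s : ι → ℝ) : Prop :=
  ∀ i, s i ∈ Icc (l i) (u i) ∧ (s i < u i → 0 ≤ k s i) ∧ (l i < s i → k s i ≤ 0)

/-- A function changes sign at most once on `D`, from negative to positive, and vanishes at most
once there. -/
def SingleCrossingOn (k : ℝ → ℝ) (D : Set ℝ) : Prop :=
  ∀ x ∈ D, ∀ y ∈ D, x < y → 0 ≤ k x → 0 < k y

/-- The marginal cost `1 - (1 + r) m` inherits the single crossing property from a positive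
decreasing marginal revenue `m`: it increases if `0 ≤ 1 + r` and is positive if `1 + r ≤ 0`. -/
theorem one_sub_mul_pos {r m m' : ℝ} (hm' : 0 < m') (hlt : m' < m)
    (h : 0 ≤ 1 - (1 + r) * m) : 0 < 1 - (1 + r) * m' := by
  rcases le_or_gt (1 + r) 0 with hr | hr
  · nlinarith [mul_nonneg (neg_nonneg.2 hr) hm'.le]
  · nlinarith [mul_lt_mul_of_pos_left hlt hr]

/-- For a function whose derivative has the single crossing property, the first-order conditions
characterize the minimizers on an interval. -/
theorem isMinOn_Icc_iff_of_singleCrossingOn {K k : ℝ → ℝ} {l u x : ℝ}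
    (hK : ContinuousOn K (Icc l u)) (hd : ∀ y ∈ Ioo l u, HasDerivAt K (k y) y)
    (hk : ContinuousOn k (Icc l u)) (hc : SingleCrossingOn k (Icc l u)) (hx : x ∈ Icc l u) :
    IsMinOn K (Icc l u) x ↔ (x < u → 0 ≤ k x) ∧ (l < x → k x ≤ 0) := by
  constructor
  · intro hmin
    constructor
    · intro hxu
      by_contra! hneg
      have hev : ∀ᶠ y in nhdsWithin x (Icc l u), k y < 0 :=
        (hk x hx).eventually (gt_mem_nhds hneg)
      obtain ⟨δ, hδ, hball⟩ := Metric.mem_nhdsWithin_iff.1 hev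
      set y := min u (x + δ / 2) with hy
      have hxy : x < y := lt_min hxu (by linarith)
      have hyu : y ≤ u := min_le_left _ _
      have hyδ : y ≤ x + δ / 2 := min_le_right _ _
      have hsub : Icc x y ⊆ Icc l u := Icc_subset_Icc hx.1 hyu
      have hanti : StrictAntiOn K (Icc x y) := by
        apply strictAntiOn_of_deriv_neg (convex_Icc _ _) (hK.mono hsub)
        intro z hz
        rw [interior_Icc] at hz
        rw [(hd z ⟨hx.1.trans_lt hz.1, hz.2.trans_le hyu⟩).deriv]
        refine hball ⟨?_, hsub (Ioo_subset_Icc_self hz)⟩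
        rw [Metric.mem_ball, Real.dist_eq, abs_lt]
        constructor <;> linarith [hz.1, hz.2]
      have h1 := hanti (left_mem_Icc.2 hxy.le) (right_mem_Icc.2 hxy.le) hxy
      have h2 := hmin (hsub (right_mem_Icc.2 hxy.le))
      simp only [mem_ofPred_eq] at h2
      linarith
    · intro hlx
      by_contra! hpos
      have hev : ∀ᶠ y in nhdsWithin x (Icc l u), 0 < k y :=
        (hk x hx).eventually (lt_mem_nhds hpos)
      obtain ⟨δ, hδ, hball⟩ := Metric.mem_nhdsWithin_iff.1 hev
      set y := max l (x - δ / 2) with hy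
      have hyx : y < x := max_lt hlx (by linarith)
      have hly : l ≤ y := le_max_left _ _
      have hyδ : x - δ / 2 ≤ y := le_max_right _ _
      have hsub : Icc y x ⊆ Icc l u := Icc_subset_Icc hly hx.2
      have hmono : StrictMonoOn K (Icc y x) := by
        apply strictMonoOn_of_deriv_pos (convex_Icc _ _) (hK.mono hsub)
        intro z hz
        rw [interior_Icc] at hz
        rw [(hd z ⟨hly.trans_lt hz.1, hz.2.trans_le hx.2⟩).deriv]
        refine hball ⟨?_, hsub (Ioo_subset_Icc_self hz)⟩
        rw [Metric.mem_ball, Real.dist_eq, abs_lt]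
        constructor <;> linarith [hz.1, hz.2]
      have h1 := hmono (left_mem_Icc.2 hyx.le) (right_mem_Icc.2 hyx.le) hyx
      have h2 := hmin (hsub (left_mem_Icc.2 hyx.le))
      simp only [mem_ofPred_eq] at h2
      linarith
  · rintro ⟨h1, h2⟩ y hy
    simp only [mem_ofPred_eq]
    rcases lt_trichotomy x y with hxy | rfl | hyx
    · have hsub : Icc x y ⊆ Icc l u := Icc_subset_Icc hx.1 hy.2
      have hmono : MonotoneOn K (Icc x y) := by
        apply monotoneOn_of_deriv_nonneg (convex_Icc _ _) (hK.mono hsub)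
        · intro z hz
          rw [interior_Icc] at hz
          exact (hd z ⟨hx.1.trans_lt hz.1, hz.2.trans_le hy.2⟩).differentiableAt
            |>.differentiableWithinAt
        · intro z hz
          rw [interior_Icc] at hz
          rw [(hd z ⟨hx.1.trans_lt hz.1, hz.2.trans_le hy.2⟩).deriv]
          exact (hc x hx z (hsub (Ioo_subset_Icc_self hz)) hz.1 (h1 (hxy.trans_le hy.2))).le
      exact hmono (left_mem_Icc.2 hxy.le) (right_mem_Icc.2 hxy.le) hxy.le
    · exact le_rfl
    · have hsub : Icc y x ⊆ Icc l u := Icc_subset_Icc hy.1 hx.2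
      have hanti : AntitoneOn K (Icc y x) := by
        apply antitoneOn_of_deriv_nonpos (convex_Icc _ _) (hK.mono hsub)
        · intro z hz
          rw [interior_Icc] at hz
          exact (hd z ⟨hy.1.trans_lt hz.1, hz.2.trans_le hx.2⟩).differentiableAt
            |>.differentiableWithinAt
        · intro z hz
          rw [interior_Icc] at hz
          rw [(hd z ⟨hy.1.trans_lt hz.1, hz.2.trans_le hx.2⟩).deriv]
          by_contra! hpos
          exact absurd (hc z (hsub (Ioo_subset_Icc_self hz)) x hx hz.2 hpos.le)
            (h2 (hy.1.trans_lt hyx)).not_gt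
      exact hanti (left_mem_Icc.2 hyx.le) (right_mem_Icc.2 hyx.le) hyx.le

/-! ### The constraint intervals -/

section Bounds

variable {n : ℕ} (a h : Fin n → ℝ) (q : ℝ) (qbar : Fin n → ℝ)

/-- The smallest liquidation available to bank `i`; an insolvent bank has to sell `a i`. -/
def lower (i : Fin n) : ℝ :=
  if h i ≤ a i * qbar i then max 0 ((h i - a i * q) / (qbar i - q)) else a i

/-- The largest liquidation available to bank `i`; an insolvent bank has to sell `a i`. -/
def upper (i : Fin n) : ℝ :=
  if h i ≤ a i * qbar i then h i / qbar i else a i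

variable {a h q qbar}

theorem lower_nonneg (ha : ∀ i, 0 < a i) (i : Fin n) : 0 ≤ lower a h q qbar i := by
  unfold lower
  split_ifs
  · exact le_max_left _ _
  · exact (ha i).le

theorem upper_pos (ha : ∀ i, 0 < a i) (hh : ∀ i, 0 < h i) (hq : 0 < q)
    (hqbar : ∀ i, q < qbar i) (i : Fin n) : 0 < upper a h qbar i := by
  unfold upper
  split_ifs
  · exact div_pos (hh i) (hq.trans (hqbar i))
  · exact ha i

theorem upper_le (hq : 0 < q) (hqbar : ∀ i, q < qbar i) (i : Fin n) :
    upper a h qbar i ≤ a i := by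
  unfold upper
  split_ifs with hs
  · exact (div_le_iff₀ (hq.trans (hqbar i))).2 hs
  · exact le_rfl

theorem lower_le_upper (hh : ∀ i, 0 < h i) (hq : 0 < q)
    (hqbar : ∀ i, q < qbar i) (i : Fin n) : lower a h q qbar i ≤ upper a h qbar i := by
  unfold lower upper
  have hb : 0 < qbar i := hq.trans (hqbar i)
  split_ifs with hs
  · refine max_le (div_pos (hh i) hb).le ?_
    rw [div_le_div_iff₀ (sub_pos.2 (hqbar i)) hb]
    nlinarith [mul_le_mul_of_nonneg_right hs hq.le]
  · exact le_rfl

theorem feasible_eq_Icc (hq : 0 < q) (hqbar : ∀ i, q < qbar i) {i : Fin n}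
    (hs : h i ≤ a i * qbar i) :
    feasible a h q qbar i = Icc (lower a h q qbar i) (upper a h qbar i) := by
  have hu := upper_le (a := a) (h := h) hq hqbar i
  ext x
  simp only [feasible, lower, upper, if_pos hs, mem_ofPred_eq, mem_Icc, max_le_iff] at hu ⊢
  constructor
  · rintro ⟨⟨h0, -⟩, h1, h2⟩
    exact ⟨⟨h0, h2⟩, h1⟩
  · rintro ⟨⟨h0, h2⟩, h1⟩
    exact ⟨⟨h0, h1.trans hu⟩, h1, h2⟩

end Bounds

theorem update_mem_admissible {n : ℕ} {a s : Fin n → ℝ} (hs : s ∈ admissible a) {i : Fin n}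
    {x : ℝ} (hx : x ∈ Icc 0 (a i)) : Function.update s i x ∈ admissible a := by
  intro j _
  rcases eq_or_ne j i with rfl | hj
  · simpa using hx
  · simpa [Function.update_of_ne hj] using hs j trivial

/-- If the revenue of every bank is differentiable in its own liquidation and the marginal revenue
is positive, continuous and strictly decreasing, the equilibria are the profiles that satisfy the
first-order conditions on the constraint box. -/
theorem isEquilibrium_iff_isKKT {n : ℕ} {a h : Fin n → ℝ} {r q : ℝ} {qbar : Fin n → ℝ}
    (ha : ∀ i, 0 < a i) (hq : 0 < q) (hqbar : ∀ i, q < qbar i)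
    {F R m : (Fin n → ℝ) → Fin n → ℝ}
    (hR : ∀ s ∈ admissible a, ∀ i, s i * F s i = R s i)
    (hRc : ∀ s ∈ admissible a, ∀ i,
      ContinuousOn (fun x => R (Function.update s i x) i) (Icc 0 (a i)))
    (hRd : ∀ s ∈ admissible a, ∀ i, ∀ x ∈ Ioo 0 (a i),
      HasDerivAt (fun x => R (Function.update s i x) i) (m (Function.update s i x) i) x)
    (hm : ∀ s ∈ admissible a, ∀ i, 0 < m s i)
    (hmc : ∀ s ∈ admissible a, ∀ i,
      ContinuousOn (fun x => m (Function.update s i x) i) (Icc 0 (a i)))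
    (hma : ∀ s ∈ admissible a, ∀ i,
      StrictAntiOn (fun x => m (Function.update s i x) i) (Icc 0 (a i)))
    (s : Fin n → ℝ) :
    IsEquilibrium F a h r q qbar s ↔
      IsKKT (lower a h q qbar) (upper a h qbar) (fun s i => 1 - (1 + r) * m s i) s := by
  have hsub : ∀ i, Icc (lower a h q qbar i) (upper a h qbar i) ⊆ Icc 0 (a i) := fun i =>
    Icc_subset_Icc (lower_nonneg ha i) (upper_le hq hqbar i)
  have hbr : ∀ s ∈ admissible a, ∀ i, s i ∈ bestResponse F a h r q qbar s i ↔
      (s i ∈ Icc (lower a h q qbar i) (upper a h qbar i) ∧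
        (s i < upper a h qbar i → 0 ≤ 1 - (1 + r) * m s i) ∧
        (lower a h q qbar i < s i → 1 - (1 + r) * m s i ≤ 0)) := by
    intro s hs i
    by_cases hsol : h i ≤ a i * qbar i
    · simp only [bestResponse, if_pos hsol, feasible_eq_Icc hq hqbar hsol, mem_ofPred_eq]
      refine and_congr_right fun hsi => ?_
      set K : ℝ → ℝ := fun x => x + r * h i - (1 + r) * R (Function.update s i x) i with hKdef
      set k : ℝ → ℝ := fun x => 1 - (1 + r) * m (Function.update s i x) i with hkdef
      have hcost : ∀ x ∈ Icc 0 (a i), cost F h r i (Function.update s i x) = K x := by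
        intro x hx
        have := hR _ (update_mem_admissible hs hx) i
        simp only [Function.update_self] at this
        simp only [cost, hKdef, Function.update_self, ← this]
        ring
      have hmin : IsMinOn (fun y => cost F h r i (Function.update s i y))
            (Icc (lower a h q qbar i) (upper a h qbar i)) (s i) ↔
          IsMinOn K (Icc (lower a h q qbar i) (upper a h qbar i)) (s i) := by
        simp only [isMinOn_iff]
        refine forall₂_congr fun y hy => ?_
        rw [hcost _ (hsub i hsi), hcost _ (hsub i hy)]
      have hks : k (s i) = 1 - (1 + r) * m s i := by simp [hkdef]
      rw [hmin, ← hks]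
      refine isMinOn_Icc_iff_of_singleCrossingOn ?_ ?_ ?_ ?_ hsi
      · exact (continuousOn_id.add continuousOn_const).sub
          (continuousOn_const.mul ((hRc s hs i).mono (hsub i)))
      · intro y hy
        have := hRd s hs i y
          ⟨(lower_nonneg ha i).trans_lt hy.1, hy.2.trans_le (upper_le hq hqbar i)⟩
        exact ((hasDerivAt_id y).add_const _).sub (this.const_mul _)
      · exact continuousOn_const.sub (continuousOn_const.mul ((hmc s hs i).mono (hsub i)))
      · intro x hx y hy hxy
        exact one_sub_mul_pos (hm _ (update_mem_admissible hs (hsub i hy)) i)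
          (hma s hs i (hsub i hx) (hsub i hy) hxy)
    · simp only [bestResponse, if_neg hsol, lower, upper, mem_singleton_iff]
      constructor
      · intro he
        simp [he]
      · rintro ⟨he, -⟩
        exact le_antisymm he.2 he.1
  constructor
  · rintro ⟨hs, hall⟩ i
    exact (hbr s hs i).1 (hall i)
  · intro hk
    have hs : s ∈ admissible a := fun i _ => hsub i (hk i).1
    exact ⟨hs, fun i => (hbr s hs i).2 (hk i)⟩

/-! ### Games in which the marginal cost depends on the depth of the order -/

section Depth

variable {ι : Type*} [Fintype ι]

/-- The part of the book consumed by the orders `s` when every seller has sold `min (s j) y`. -/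
def depth (s : ι → ℝ) (y : ℝ) : ℝ := ∑ j, min (s j) y

theorem depth_mono (s : ι → ℝ) : Monotone (depth s) := fun _ _ h =>
  Finset.sum_le_sum fun _ _ => min_le_min_left _ h

theorem continuous_depth (s : ι → ℝ) : Continuous (depth s) :=
  continuous_finsetSum _ fun _ _ => continuous_const.min continuous_id

theorem depth_le_sum (s : ι → ℝ) (y : ℝ) : depth s y ≤ ∑ j, s j :=
  Finset.sum_le_sum fun _ _ => min_le_left _ _

theorem depth_nonneg {s : ι → ℝ} (hs : ∀ j, 0 ≤ s j) {y : ℝ} (hy : 0 ≤ y) : 0 ≤ depth s y :=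
  Finset.sum_nonneg fun j _ => le_min (hs j) hy

theorem depth_zero {s : ι → ℝ} (hs : ∀ j, 0 ≤ s j) : depth s 0 = 0 := by
  simp [depth, hs]

theorem depth_lt_depth {s : ι → ℝ} {i : ι} {y z : ℝ} (hyz : y < z) (hz : z ≤ s i) :
    depth s y < depth s z := by
  refine Finset.sum_lt_sum (fun _ _ => min_le_min_left _ hyz.le) ⟨i, Finset.mem_univ _, ?_⟩
  rw [min_eq_right (hyz.le.trans hz), min_eq_right hz]
  exact hyz

variable {l u : ι → ℝ} {g : ℝ → ℝ} {M : ℝ}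

/-- Two solutions agree: at a coordinate where they differ and whose smaller entry `x` is least
possible, both profiles have the same depth at `x`, while the marginal costs of that player force
the depth to decrease strictly from the smaller to the larger entry. -/
theorem isKKT_depth_unique (hl : ∀ i, 0 ≤ l i) (hu : ∑ i, u i ≤ M)
    (hg : SingleCrossingOn g (Icc 0 M)) {s t : ι → ℝ}
    (hs : IsKKT l u (fun s i => g (depth s (s i))) s)
    (ht : IsKKT l u (fun s i => g (depth s (s i))) t) : s = t := by
  by_contra hne
  obtain ⟨i₀, hi₀⟩ := Function.ne_iff.1 hne
  obtain ⟨i, hi, hmin⟩ := Finset.exists_min_image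
    (Finset.univ.filter fun i => s i ≠ t i) (fun i => min (s i) (t i)) ⟨i₀, by simpa using hi₀⟩
  simp only [Finset.mem_filter, Finset.mem_univ, true_and] at hi hmin
  wlog hlt : s i < t i generalizing s t
  · refine this ht hs (Ne.symm hne) hi₀.symm hi.symm (fun j hj => ?_)
      (lt_of_le_of_ne (not_lt.1 hlt) hi.symm)
    rw [min_comm (t i), min_comm (t j)]
    exact hmin j hj.symm
  rw [min_eq_left hlt.le] at hmin
  have hmem : ∀ {v : ι → ℝ}, IsKKT l u (fun s i => g (depth s (s i))) v →
      depth v (v i) ∈ Icc 0 M := fun {v} hv =>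
    ⟨depth_nonneg (fun j => (hl j).trans (hv j).1.1) ((hl i).trans (hv i).1.1),
      (depth_le_sum _ _).trans ((Finset.sum_le_sum fun j _ => (hv j).1.2).trans hu)⟩
  have heq : depth s (s i) = depth t (s i) := by
    refine Finset.sum_congr rfl fun j _ => ?_
    by_cases hj : s j = t j
    · rw [hj]
    · have := le_min_iff.1 (hmin j hj)
      rw [min_eq_right this.1, min_eq_right this.2]
  have hdlt : depth s (s i) < depth t (t i) := heq ▸ depth_lt_depth hlt le_rfl
  have h1 := (hs i).2.1 (hlt.trans_le (ht i).1.2)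
  have h2 := (ht i).2.2 ((hs i).1.1.trans_lt hlt)
  exact absurd (hg _ (hmem hs) _ (hmem ht) hdlt h1) h2.not_gt

/-- A solution is obtained by clamping one common level `z` to the constraint intervals. -/
theorem exists_isKKT_depth (hl : ∀ i, 0 ≤ l i) (hlu : ∀ i, l i ≤ u i) (hu : ∑ i, u i ≤ M)
    (hgc : ContinuousOn g (Icc 0 M)) (hg : SingleCrossingOn g (Icc 0 M)) :
    ∃ s, IsKKT l u (fun s i => g (depth s (s i))) s := by
  have hu0 : ∀ i, 0 ≤ u i := fun i => (hl i).trans (hlu i)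
  set Z : ℝ := ∑ i, u i with hZ
  have hZ0 : 0 ≤ Z := Finset.sum_nonneg fun i _ => hu0 i
  have huZ : ∀ i, u i ≤ Z := fun i =>
    Finset.single_le_sum (fun j _ => hu0 j) (Finset.mem_univ i)
  have hmaps : MapsTo (depth u) (Icc 0 Z) (Icc 0 M) := fun z hz =>
    ⟨depth_nonneg hu0 hz.1, (depth_le_sum _ _).trans hu⟩
  -- the level at which the marginal cost changes sign, if it does
  obtain ⟨z, hz, hz1, hz2⟩ : ∃ z ∈ Icc 0 Z, (z < Z → 0 ≤ g (depth u z)) ∧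
      (0 < z → g (depth u z) ≤ 0) := by
    rcases le_or_gt 0 (g (depth u 0)) with h0 | h0
    · exact ⟨0, left_mem_Icc.2 hZ0, fun _ => h0, fun h => absurd h (lt_irrefl _)⟩
    rcases le_or_gt (g (depth u Z)) 0 with h1 | h1
    · exact ⟨Z, right_mem_Icc.2 hZ0, fun h => absurd h (lt_irrefl _), fun _ => h1⟩
    obtain ⟨z, hz, hgz⟩ := intermediate_value_Icc hZ0
      (hgc.comp (continuous_depth u).continuousOn hmaps) ⟨h0.le, h1.le⟩
    simp only [Function.comp_apply] at hgz
    exact ⟨z, hz, fun _ => hgz.ge, fun _ => hgz.le⟩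
  set s : ι → ℝ := fun i => max (l i) (min (u i) z) with hsdef
  have hsl : ∀ i, l i ≤ s i := fun i => le_max_left _ _
  have hsu : ∀ i, s i ≤ u i := fun i => max_le (hlu i) (min_le_left _ _)
  have hs0 : ∀ i, 0 ≤ s i := fun i => (hl i).trans (hsl i)
  have hdz : depth s z = depth u z := by
    refine Finset.sum_congr rfl fun i _ => ?_
    simp only [hsdef]
    rcases le_total z (l i) with h | h
    · rw [min_eq_right (h.trans (le_max_left _ _)), min_eq_right (h.trans (hlu i))]
    · rw [max_eq_right (le_min (hlu i) h), min_assoc, min_self]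
  have hmem : ∀ y, 0 ≤ y → depth s y ∈ Icc 0 M := fun y hy =>
    ⟨depth_nonneg hs0 hy, (depth_le_sum _ _).trans
      ((Finset.sum_le_sum fun i _ => hsu i).trans hu)⟩
  refine ⟨s, fun i => ⟨⟨hsl i, hsu i⟩, fun h => ?_, fun h => ?_⟩⟩
  · have hzs : z ≤ s i := by
      by_contra! hc
      have h1 : min (u i) z ≤ s i := le_max_right _ _
      rcases min_le_iff.1 h1 with h2 | h2 <;> linarith
    have hg0 : 0 ≤ g (depth s z) := hdz ▸ hz1 (by linarith [huZ i])
    rcases (depth_mono s hzs).eq_or_lt with he | hlt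
    · simpa only [← he] using hg0
    · exact (hg _ (hmem z hz.1) _ (hmem _ (hs0 i)) hlt hg0).le
  · have hsz : s i ≤ z := by
      rcases max_choice (l i) (min (u i) z) with he | he
      · exact absurd he h.ne'
      · exact he.le.trans (min_le_right _ _)
    have hg0 : g (depth s z) ≤ 0 := hdz ▸ hz2 (by linarith [hl i])
    by_contra! hc
    rcases (depth_mono s hsz).eq_or_lt with he | hlt
    · exact absurd (he ▸ hc) hg0.not_gt
    · exact absurd (hg _ (hmem _ (hs0 i)) _ (hmem z hz.1) hlt hc.le) hg0.not_gt

end Depth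

/-! ### Games with proportional sharing -/

section Share

/-- The average `∫ v in 0..1, f (S v)` of the density over `[0, S]`; it equals `f 0` at `S = 0`. -/
def average (f : ℝ → ℝ) (S : ℝ) : ℝ := ∫ v in (0 : ℝ)..1, f (S * v)

/-- Marginal revenue of a bank with share `w` of the total sale `S` under average pricing: a convex
combination of the average price and of the price of the last unit sold. -/
def shareMarginal (f : ℝ → ℝ) (w S : ℝ) : ℝ := average f S - w * (average f S - f S)

variable {f : ℝ → ℝ} {M : ℝ}

theorem mul_average (f : ℝ → ℝ) (S : ℝ) : S * average f S = ∫ σ in (0 : ℝ)..S, f σ := by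
  simp [average]

theorem average_zero (f : ℝ → ℝ) : average f 0 = f 0 := by
  simp [average]

theorem continuous_average (hf : Continuous f) : Continuous (average f) :=
  intervalIntegral.continuous_parametric_intervalIntegral_of_continuous'
    (f := fun S v => f (S * v)) (by fun_prop) 0 1

theorem average_lt_average (hf : Continuous f) (hanti : StrictAntiOn f (Icc 0 M)) {S T : ℝ}
    (hS : 0 ≤ S) (hST : S < T) (hT : T ≤ M) : average f T < average f S := by
  have hlt : ∀ v ∈ Ioc (0 : ℝ) 1, f (T * v) < f (S * v) := fun v hv =>
    hanti ⟨mul_nonneg hS hv.1.le, by nlinarith [hv.1, hv.2]⟩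
      ⟨mul_nonneg (hS.trans hST.le) hv.1.le, by nlinarith [hv.1, hv.2]⟩
      (mul_lt_mul_of_pos_right hST hv.1)
  exact intervalIntegral.integral_lt_integral_of_continuousOn_of_le_of_exists_lt zero_lt_one
    (by fun_prop) (by fun_prop) (fun v hv => (hlt v hv).le) ⟨1, by simp, hlt 1 (by simp)⟩

theorem lt_average (hf : Continuous f) (hanti : StrictAntiOn f (Icc 0 M)) {S : ℝ}
    (hS : 0 < S) (hSM : S ≤ M) : f S < average f S := by
  have hlt : ∀ v ∈ Ico (0 : ℝ) 1, f S < f (S * v) := fun v hv =>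
    hanti ⟨mul_nonneg hS.le hv.1, by nlinarith [hv.1, hv.2]⟩ ⟨hS.le, hSM⟩
      (by nlinarith [hv.1, hv.2])
  have := intervalIntegral.integral_lt_integral_of_continuousOn_of_le_of_exists_lt
    (f := fun _ : ℝ => f S) (g := fun v => f (S * v)) zero_lt_one
    (by fun_prop) (by fun_prop) (fun v hv => ?_) ⟨0, by simp, hlt 0 (by simp)⟩
  · simpa [average] using this
  · rcases hv.2.eq_or_lt with rfl | h1
    · simp
    · exact (hlt v ⟨hv.1.le, h1⟩).le

theorem hasDerivAt_average (hf : Continuous f) {S : ℝ} (hS : 0 < S) :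
    HasDerivAt (average f) ((f S - average f S) / S) S := by
  have h1 : HasDerivAt (fun T => ∫ σ in (0 : ℝ)..T, f σ) (f S) S :=
    intervalIntegral.integral_hasDerivAt_right (hf.intervalIntegrable _ _)
      (hf.stronglyMeasurableAtFilter _ _) hf.continuousAt
  have h2 := h1.div (hasDerivAt_id S) hS.ne'
  have heq : average f =ᶠ[nhds S] (fun T => ∫ σ in (0 : ℝ)..T, f σ) / id := by
    filter_upwards [lt_mem_nhds hS] with T hT
    rw [Pi.div_apply, id, ← mul_average, mul_div_cancel_left₀ _ hT.ne']
  refine (h2.congr_of_eventuallyEq heq).congr_deriv ?_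
  rw [← mul_average]
  simp only [id]
  field_simp

theorem le_average (hf : Continuous f) (hanti : StrictAntiOn f (Icc 0 M)) {S : ℝ}
    (hS : 0 ≤ S) (hSM : S ≤ M) : f S ≤ average f S := by
  rcases hS.eq_or_lt with rfl | h
  · rw [average_zero]
  · exact (lt_average hf hanti h hSM).le

theorem shareMarginal_pos (hf : Continuous f) (hanti : StrictAntiOn f (Icc 0 M))
    (hpos : ∀ x ∈ Icc 0 M, 0 < f x) {w S : ℝ} (hw1 : w ≤ 1)
    (hS : S ∈ Icc 0 M) : 0 < shareMarginal f w S := by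
  have h1 := le_average hf hanti hS.1 hS.2
  have h2 := hpos S hS
  unfold shareMarginal
  nlinarith [mul_nonneg (sub_nonneg.2 hw1) (sub_nonneg.2 h1)]

/-- The marginal revenue decreases strictly in the total sale and, away from `S = 0`, in the
share. -/
theorem shareMarginal_lt (hf : Continuous f) (hanti : StrictAntiOn f (Icc 0 M)) {w w' S S' : ℝ}
    (hw : w ≤ w') (hw0 : 0 ≤ w') (hw1 : w' ≤ 1) (hS : 0 ≤ S) (hSS : S ≤ S') (hSM : S' ≤ M)
    (hstrict : S < S' ∨ (w < w' ∧ 0 < S)) : shareMarginal f w' S' < shareMarginal f w S := by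
  unfold shareMarginal
  have h1 := le_average hf hanti hS (hSS.trans hSM)
  rcases hSS.eq_or_lt with rfl | hlt
  · rcases hstrict with h | ⟨h, h0⟩
    · exact absurd h (lt_irrefl _)
    · have h2 := lt_average hf hanti h0 hSM
      nlinarith [mul_pos (sub_pos.2 h) (sub_pos.2 h2)]
  · have h2 := average_lt_average hf hanti hS hlt hSM
    have h3 := hanti ⟨hS, hSS.trans hSM⟩ ⟨hS.trans hSS, hSM⟩ hlt
    have h4 := mul_nonneg (sub_nonneg.2 hw) (sub_nonneg.2 h1)
    rcases hw0.eq_or_lt with h5 | h5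
    · rw [← h5] at h4 ⊢
      linarith
    · nlinarith [mul_nonneg (sub_nonneg.2 hw1) (sub_nonneg.2 h2.le),
        mul_pos h5 (sub_pos.2 h3)]

variable {ι : Type*} [Fintype ι] {l u : ι → ℝ} {r : ℝ}

/-- Two solutions agree. If the totals are equal, compare a coordinate that increases. If the total
increases, some seller with a positive sale has a share that does not decrease, hence a
larger sale, and both effects raise this seller's marginal cost. -/
theorem isKKT_share_unique (hf : Continuous f) (hanti : StrictAntiOn f (Icc 0 M))
    (hpos : ∀ x ∈ Icc 0 M, 0 < f x) (hl : ∀ i, 0 ≤ l i) (hu : ∑ i, u i ≤ M) {s t : ι → ℝ}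
    (hs : IsKKT l u (fun s i => 1 - (1 + r) * shareMarginal f (s i / ∑ j, s j) (∑ j, s j)) s)
    (ht : IsKKT l u (fun s i => 1 - (1 + r) * shareMarginal f (s i / ∑ j, s j) (∑ j, s j)) t) :
    s = t := by
  by_contra hne
  wlog hle : ∑ j, s j ≤ ∑ j, t j generalizing s t
  · exact this ht hs (Ne.symm hne) (not_le.1 hle).le
  have hs0 : ∀ i, 0 ≤ s i := fun i => (hl i).trans (hs i).1.1
  have ht0 : ∀ i, 0 ≤ t i := fun i => (hl i).trans (ht i).1.1
  set S := ∑ j, s j with hS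
  set T := ∑ j, t j with hT
  have hS0 : 0 ≤ S := Finset.sum_nonneg fun i _ => hs0 i
  have hT0 : 0 ≤ T := Finset.sum_nonneg fun i _ => ht0 i
  have hTM : T ≤ M := (Finset.sum_le_sum fun i _ => (ht i).1.2).trans hu
  have htT : ∀ i, t i ≤ T := fun i =>
    Finset.single_le_sum (fun j _ => ht0 j) (Finset.mem_univ i)
  have hwt : ∀ i, t i / T ≤ 1 := fun i => div_le_one_of_le₀ (htT i) hT0
  obtain ⟨i, hlt, hw, hstrict⟩ : ∃ i, s i < t i ∧ s i / S ≤ t i / T ∧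
      (S < T ∨ (s i / S < t i / T ∧ 0 < S)) := by
    rcases hle.eq_or_lt with heq | hlt
    · have : ∃ i, s i < t i := by
        by_contra! hc
        refine hne (funext fun i => ?_)
        exact ((Finset.sum_eq_sum_iff_of_le fun i _ => hc i).1 heq.symm i
          (Finset.mem_univ i)).symm
      obtain ⟨i, hi⟩ := this
      have hTpos : 0 < T := ((hs0 i).trans_lt hi).trans_le (htT i)
      have : s i / S < t i / T := by
        rw [heq]
        exact div_lt_div_of_pos_right hi hTpos
      exact ⟨i, hi, this.le, Or.inr ⟨this, heq ▸ hTpos⟩⟩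
    · have hTpos : 0 < T := hS0.trans_lt hlt
      have : ∃ i, 0 < t i ∧ s i / S ≤ t i / T := by
        by_contra! hc
        obtain ⟨j, -, hj⟩ := Finset.exists_lt_of_sum_lt (s := Finset.univ)
          (f := fun _ : ι => (0 : ℝ)) (g := t) (by simpa using hTpos)
        have hsum : ∑ i, t i / T < ∑ i, s i / S := by
          refine Finset.sum_lt_sum (fun i _ => ?_) ⟨j, Finset.mem_univ j, hc j hj⟩
          rcases (ht0 i).eq_or_lt with h0 | h0
          · rw [← h0, zero_div]
            exact div_nonneg (hs0 i) hS0
          · exact (hc i h0).le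
        rw [← Finset.sum_div, ← Finset.sum_div, ← hT, ← hS, div_self hTpos.ne'] at hsum
        exact absurd (div_self_le_one S) hsum.not_ge
      obtain ⟨i, hi, hw⟩ := this
      refine ⟨i, ?_, hw, Or.inl hlt⟩
      rcases hS0.eq_or_lt with h0 | h0
      · have := (Finset.sum_eq_zero_iff_of_nonneg fun i _ => hs0 i).1 h0.symm i
          (Finset.mem_univ i)
        rwa [this]
      · calc s i = s i / S * S := (div_mul_cancel₀ _ h0.ne').symm
          _ ≤ t i / T * S := mul_le_mul_of_nonneg_right hw hS0
          _ < t i / T * T := mul_lt_mul_of_pos_left hlt (div_pos hi hTpos)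
          _ = t i := div_mul_cancel₀ _ hTpos.ne'
  have h1 := (hs i).2.1 (hlt.trans_le (ht i).1.2)
  have h2 := (ht i).2.2 ((hs i).1.1.trans_lt hlt)
  exact absurd (one_sub_mul_pos (shareMarginal_pos hf hanti hpos (hwt i) ⟨hT0, hTM⟩)
    (shareMarginal_lt hf hanti hw (div_nonneg (ht0 i) hT0) (hwt i) hS0 hle hTM hstrict) h1)
    h2.not_gt

/-- A total `S` solves the game if the individual optima `max l (min u (S w))`, where `w` is the
share at which the marginal cost at `S` vanishes, add up to `S`; such an `S` exists by the
intermediate value theorem. -/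
theorem exists_isKKT_share (hf : Continuous f) (hanti : StrictAntiOn f (Icc 0 M))
    (hpos : ∀ x ∈ Icc 0 M, 0 < f x) (hf0 : f 0 = 1)
    (hl : ∀ i, 0 ≤ l i) (hlu : ∀ i, l i ≤ u i) (hupos : ∀ i, 0 < u i) (hu : ∑ i, u i ≤ M) :
    ∃ s, IsKKT l u
      (fun s i => 1 - (1 + r) * shareMarginal f (s i / ∑ j, s j) (∑ j, s j)) s := by
  have hL0 : 0 ≤ ∑ i, l i := Finset.sum_nonneg fun i _ => hl i
  have hLU : ∑ i, l i ≤ ∑ i, u i := Finset.sum_le_sum fun i _ => hlu i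
  -- selling as little as possible is optimal as soon as all marginal costs are nonnegative there
  have hlow : (∀ i, 0 ≤ 1 - (1 + r) * shareMarginal f (l i / ∑ j, l j) (∑ j, l j)) →
      ∃ s, IsKKT l u
        (fun s i => 1 - (1 + r) * shareMarginal f (s i / ∑ j, s j) (∑ j, s j)) s := fun hk =>
    ⟨l, fun i => ⟨⟨le_rfl, hlu i⟩, fun _ => hk i, fun h => absurd h (lt_irrefl _)⟩⟩
  rcases le_or_gt (1 + r) 0 with hr | hr
  · refine hlow fun i => ?_
    have := shareMarginal_pos hf hanti hpos (div_le_one_of_le₀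
      (Finset.single_le_sum (fun j _ => hl j) (Finset.mem_univ i)) hL0) ⟨hL0, hLU.trans hu⟩
    nlinarith [mul_nonneg (neg_nonneg.2 hr) this.le]
  by_cases hcase : ∑ i, l i = 0 ∧ r ≤ 0
  · refine hlow fun i => ?_
    rw [hcase.1, shareMarginal, average_zero, hf0]
    linarith [hcase.2]
  rcases isEmpty_or_nonempty ι with hι | ⟨⟨i⟩⟩
  · exact hlow isEmptyElim
  -- at the price `c` selling another unit is neutral
  set c : ℝ := 1 / (1 + r) with hc
  have hrc : (1 + r) * c = 1 := by rw [hc]; field_simp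
  set x : ι → ℝ → ℝ := fun i S =>
    max (l i) (min (u i) (S * ((average f S - c) / (average f S - f S)))) with hx
  have hxl : ∀ i S, l i ≤ x i S := fun i S => le_max_left _ _
  have hxu : ∀ i S, x i S ≤ u i := fun i S => max_le (hlu i) (min_le_left _ _)
  suffices hS₀ : (∃ S₀, 0 < S₀ ∧ S₀ ≤ ∑ i, u i ∧ S₀ ≤ ∑ i, x i S₀) by
    obtain ⟨S₀, h0, hS₀u, hS₀x⟩ := hS₀
    have hcont : ContinuousOn (fun S => ∑ i, x i S - S) (Icc S₀ (∑ i, u i)) := by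
      refine (continuousOn_finsetSum _ fun i _ => ?_).sub continuousOn_id
      refine continuousOn_const.sup (continuousOn_const.inf (continuousOn_id.mul ?_))
      refine ((continuous_average hf).continuousOn.sub continuousOn_const).div
        ((continuous_average hf).continuousOn.sub hf.continuousOn) fun S hS => ?_
      exact (sub_pos.2 (lt_average hf hanti (h0.trans_le hS.1) (hS.2.trans hu))).ne'
    obtain ⟨S, hS, hSx⟩ := intermediate_value_Icc' hS₀u hcont (show (0 : ℝ) ∈ _ from
      ⟨sub_nonpos.2 (Finset.sum_le_sum fun i _ => hxu i _), sub_nonneg.2 hS₀x⟩)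
    have hSsum : ∑ i, x i S = S := sub_eq_zero.1 hSx
    have hSpos : 0 < S := h0.trans_le hS.1
    have hgap : 0 < average f S - f S :=
      sub_pos.2 (lt_average hf hanti hSpos (hS.2.trans hu))
    set w : ℝ := (average f S - c) / (average f S - f S) with hw
    have hwgap : w * (average f S - f S) = average f S - c := div_mul_cancel₀ _ hgap.ne'
    refine ⟨fun i => x i S, fun i => ⟨⟨hxl i S, hxu i S⟩, fun h => ?_, fun h => ?_⟩⟩
    · simp only [hSsum, shareMarginal]
      have hle : w ≤ x i S / S := by
        rw [le_div_iff₀ hSpos, mul_comm]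
        by_contra! hcon
        have h1 : min (u i) (S * w) ≤ x i S := le_max_right _ _
        rcases min_le_iff.1 h1 with h2 | h2 <;> linarith
      nlinarith [mul_nonneg hr.le (mul_nonneg (sub_nonneg.2 hle) hgap.le)]
    · simp only [hSsum, shareMarginal]
      have hle : x i S / S ≤ w := by
        rw [div_le_iff₀ hSpos, mul_comm]
        rcases max_choice (l i) (min (u i) (S * w)) with he | he
        · exact absurd he h.ne'
        · exact he.le.trans (min_le_right _ _)
      nlinarith [mul_nonneg hr.le (mul_nonneg (sub_nonneg.2 hle) hgap.le)]
  rcases hL0.eq_or_lt with hL | hL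
  · -- near `0` the price exceeds `c`, so player `i` alone already wants to sell a small total `S₀`
    have hr0 : 0 < r := not_le.1 fun h => hcase ⟨hL.symm, h⟩
    have hc1 : c < f 0 := by
      rw [hf0, hc, div_lt_one hr]
      linarith
    obtain ⟨δ, hδ, hball⟩ := Metric.eventually_nhds_iff.1
      (hf.continuousAt.eventually (lt_mem_nhds hc1))
    have hiU : u i ≤ ∑ j, u j :=
      Finset.single_le_sum (fun j _ => (hupos j).le) (Finset.mem_univ i)
    set S₀ : ℝ := min (u i) (δ / 2) with hS₀
    have hS₀pos : 0 < S₀ := lt_min (hupos i) (half_pos hδ)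
    have hS₀u : S₀ ≤ u i := min_le_left _ _
    have hgap : 0 < average f S₀ - f S₀ :=
      sub_pos.2 (lt_average hf hanti hS₀pos (hS₀u.trans (hiU.trans hu)))
    have hcS₀ : c < f S₀ := by
      refine hball ?_
      rw [Real.dist_eq, sub_zero, abs_of_pos hS₀pos]
      exact (min_le_right _ _).trans_lt (half_lt_self hδ)
    have hw1 : 1 ≤ (average f S₀ - c) / (average f S₀ - f S₀) := by
      rw [one_le_div hgap]
      linarith
    refine ⟨S₀, hS₀pos, hS₀u.trans hiU, ?_⟩
    have hxi : S₀ ≤ x i S₀ :=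
      (le_min hS₀u (le_mul_of_one_le_right hS₀pos.le hw1)).trans (le_max_right _ _)
    exact hxi.trans (Finset.single_le_sum (f := fun j => x j S₀)
      (fun j _ => (hl j).trans (hxl j _)) (Finset.mem_univ i))
  · exact ⟨∑ i, l i, hL, hLU, Finset.sum_le_sum fun i _ => hxl i _⟩

end Share

/-! ### Volume weighted average price -/

section Vwap

variable {n : ℕ} {f g : ℝ → ℝ} {M : ℝ} {a : Fin n → ℝ}

theorem sum_mem_Icc_of_mem_admissible (hM : ∑ i, a i ≤ M) {s : Fin n → ℝ}
    (hs : s ∈ admissible a) : ∑ j, s j ∈ Icc 0 M :=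
  ⟨Finset.sum_nonneg fun j _ => (hs j trivial).1,
    (Finset.sum_le_sum fun j _ => (hs j trivial).2).trans hM⟩

theorem mul_vwapPrice (hfg : EqOn f g (Icc 0 M)) (hM : ∑ i, a i ≤ M) {s : Fin n → ℝ}
    (hs : s ∈ admissible a) (i : Fin n) :
    s i * vwapPrice f s i = s i * average g (∑ j, s j) := by
  by_cases h0 : s = 0
  · simp [h0]
  have hS := sum_mem_Icc_of_mem_admissible hM hs
  have hne : ∑ j, s j ≠ 0 := fun h => h0 <| funext fun j =>
    (Finset.sum_eq_zero_iff_of_nonneg fun j _ => (hs j trivial).1).1 h j (Finset.mem_univ j)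
  have hint : ∫ σ in (0 : ℝ)..(∑ j, s j), f σ = ∫ σ in (0 : ℝ)..(∑ j, s j), g σ := by
    refine intervalIntegral.integral_congr fun σ hσ => hfg ?_
    rw [uIcc_of_le hS.1] at hσ
    exact ⟨hσ.1, hσ.2.trans hS.2⟩
  rw [vwapPrice, if_neg h0, hint, ← mul_average, mul_div_cancel_left₀ _ hne]

theorem isEquilibrium_vwapPrice_iff {h : Fin n → ℝ} {r q : ℝ} {qbar : Fin n → ℝ}
    (ha : ∀ i, 0 < a i) (hq : 0 < q) (hqbar : ∀ i, q < qbar i) (hM : ∑ i, a i ≤ M)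
    (hfg : EqOn f g (Icc 0 M)) (hg : Continuous g) (hanti : StrictAntiOn g (Icc 0 M))
    (hpos : ∀ x ∈ Icc 0 M, 0 < g x) (s : Fin n → ℝ) :
    IsEquilibrium (vwapPrice f) a h r q qbar s ↔
      IsKKT (lower a h q qbar) (upper a h qbar)
        (fun s i => 1 - (1 + r) * shareMarginal g (s i / ∑ j, s j) (∑ j, s j)) s := by
  have hsum : ∀ (s : Fin n → ℝ) (i : Fin n) (x : ℝ),
      ∑ j, Function.update s i x j = x + ∑ j ∈ Finset.univ \ {i}, s j := fun s i x =>
    Finset.sum_update_of_mem (Finset.mem_univ i) s x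
  have ht0 : ∀ s ∈ admissible a, ∀ i, 0 ≤ ∑ j ∈ Finset.univ \ {i}, s j := fun s hs i =>
    Finset.sum_nonneg fun j _ => (hs j trivial).1
  have htM : ∀ s ∈ admissible a, ∀ i, ∀ x ∈ Icc 0 (a i),
      x + ∑ j ∈ Finset.univ \ {i}, s j ≤ M := fun s hs i x hx => by
    rw [← hsum]
    exact (sum_mem_Icc_of_mem_admissible hM (update_mem_admissible hs hx)).2
  refine isEquilibrium_iff_isKKT (m := fun s i => shareMarginal g (s i / ∑ j, s j) (∑ j, s j))
    ha hq hqbar (fun s hs i => mul_vwapPrice hfg hM hs i) ?_ ?_ ?_ ?_ ?_ s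
  · intro s hs i
    simp only [hsum, Function.update_self]
    exact (continuous_id.mul ((continuous_average hg).comp
      (continuous_id.add continuous_const))).continuousOn
  · intro s hs i x hx
    simp only [hsum, Function.update_self]
    set t := ∑ j ∈ Finset.univ \ {i}, s j
    have hS : 0 < x + t := add_pos_of_pos_of_nonneg hx.1 (ht0 s hs i)
    have h1 : HasDerivAt (fun x => average g (x + t)) _ x :=
      (hasDerivAt_average hg hS).comp_add_const x t
    refine ((hasDerivAt_id x).mul h1).congr_deriv ?_
    simp only [shareMarginal, id]
    ring
  · intro s hs i
    exact shareMarginal_pos hg hanti hpos (div_le_one_of_le₀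
      (Finset.single_le_sum (fun j _ => (hs j trivial).1) (Finset.mem_univ i))
      (sum_mem_Icc_of_mem_admissible hM hs).1) (sum_mem_Icc_of_mem_admissible hM hs)
  · intro s hs i
    simp only [hsum, Function.update_self]
    rcases (ht0 s hs i).eq_or_lt with ht | ht
    · -- without other sellers the share is `1`, except for `0 / 0 = 0` at `x = 0`, where it does
      -- not matter because the average price equals the price of the last unit
      rw [← ht]
      refine hg.continuousOn.congr fun x _ => ?_
      rcases eq_or_ne x 0 with rfl | hx
      · simp [shareMarginal, average_zero]
      · simp [shareMarginal, div_self hx]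
    · have hadd : ContinuousOn (fun x : ℝ => x + ∑ j ∈ Finset.univ \ {i}, s j) (Icc 0 (a i)) :=
        continuousOn_id.add continuousOn_const
      have hav := (continuous_average hg).comp_continuousOn hadd
      have hshare := continuousOn_id.div hadd fun x hx => (add_pos_of_nonneg_of_pos hx.1 ht).ne'
      exact hav.sub (hshare.mul (hav.sub (hg.comp_continuousOn hadd)))
  · intro s hs i x hx y hy hxy
    simp only [hsum, Function.update_self]
    have ht := ht0 s hs i
    have htM' := htM s hs i y hy
    set t := ∑ j ∈ Finset.univ \ {i}, s j
    have hy0 : 0 < y := hx.1.trans_lt hxy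
    have hyt : 0 < y + t := add_pos_of_pos_of_nonneg hy0 ht
    refine shareMarginal_lt hg hanti ?_ (div_nonneg hy0.le hyt.le)
      (div_le_one_of_le₀ (le_add_of_nonneg_right ht) hyt.le) (add_nonneg hx.1 ht)
      (add_le_add_left hxy.le t) htM' (Or.inl (add_lt_add_left hxy t))
    rcases (add_nonneg hx.1 ht).eq_or_lt with h0 | h0
    · rw [← h0, div_zero]
      exact div_nonneg hy0.le hyt.le
    · rw [div_le_div_iff₀ h0 hyt]
      nlinarith [mul_le_mul_of_nonneg_right hxy.le ht]

end Vwap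

/-! ### Limit order book -/

section Lob

variable {n : ℕ}

theorem orderStat_zero (s : Fin n → ℝ) : orderStat s 0 = 0 := by
  simp [orderStat]

theorem orderStat_succ (s : Fin n → ℝ) {k : ℕ} (hk : k < n) :
    orderStat s (k + 1) = s (Tuple.sort s ⟨k, hk⟩) := by
  rw [orderStat, dif_pos ⟨by omega, by omega⟩]
  simp

theorem orderStat_le_succ {s : Fin n → ℝ} (hs : ∀ j, 0 ≤ s j) {k : ℕ} (hk : k < n) :
    orderStat s k ≤ orderStat s (k + 1) := by
  rw [orderStat_succ s hk]
  rcases k with _ | k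
  · rw [orderStat_zero]
    exact hs _
  · rw [orderStat_succ s (by omega)]
    exact Tuple.monotone_sort s (by simp)

theorem orderStat_nonneg {s : Fin n → ℝ} (hs : ∀ j, 0 ≤ s j) (k : ℕ) : 0 ≤ orderStat s k := by
  unfold orderStat
  split_ifs
  · exact hs _
  · exact le_rfl

/-- Between consecutive order statistics the depth is affine, its slope being the number of banks
that are still selling. -/
theorem depth_sub_depth_orderStat (s : Fin n → ℝ) {k : ℕ} (hk : k < n) {y : ℝ}
    (hy : y ∈ Icc (orderStat s k) (orderStat s (k + 1))) :
    depth s y - depth s (orderStat s k) = (n - k) * (y - orderStat s k) := by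
  have hsort : ∀ z, depth s z = ∑ m, min (s (Tuple.sort s m)) z := fun z =>
    (Equiv.sum_comp (Tuple.sort s) fun j => min (s j) z).symm
  have hterm : ∀ m : Fin n, min (s (Tuple.sort s m)) y - min (s (Tuple.sort s m)) (orderStat s k)
      = if m ∈ Finset.Ici (⟨k, hk⟩ : Fin n) then y - orderStat s k else 0 := by
    intro m
    split_ifs with hm <;> rw [Finset.mem_Ici, Fin.le_def] at hm
    · have h1 : orderStat s (k + 1) ≤ s (Tuple.sort s m) := by
        rw [orderStat_succ s hk]
        exact Tuple.monotone_sort s (Fin.le_def.2 hm)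
      rw [min_eq_right (hy.2.trans h1), min_eq_right (hy.1.trans (hy.2.trans h1))]
    · have hkm : ¬ k ≤ (m : ℕ) := hm
      obtain ⟨k, rfl⟩ : ∃ k', k = k' + 1 := ⟨k - 1, by omega⟩
      have h1 : s (Tuple.sort s m) ≤ orderStat s (k + 1) := by
        rw [orderStat_succ s (by omega)]
        refine Tuple.monotone_sort s (Fin.le_def.2 ?_)
        simp only
        omega
      rw [min_eq_left h1, min_eq_left (h1.trans hy.1), sub_self]
  rw [hsort, hsort, ← Finset.sum_sub_distrib, Finset.sum_congr rfl fun m _ => hterm m,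
    Finset.sum_ite_mem, Finset.univ_inter, Finset.sum_const, Fin.card_Ici, nsmul_eq_mul,
    Nat.cast_sub hk.le]

theorem bookDepth_succ (s : Fin n → ℝ) (k : ℕ) :
    bookDepth s (k + 1) = bookDepth s k + (n - k) * (orderStat s (k + 1) - orderStat s k) := by
  rw [bookDepth, Finset.sum_Icc_succ_top (by omega), ← bookDepth]
  push_cast
  simp

theorem bookDepth_eq_depth {s : Fin n → ℝ} (hs : ∀ j, 0 ≤ s j) {k : ℕ} (hk : k ≤ n) :
    bookDepth s k = depth s (orderStat s k) := by
  induction k with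
  | zero => simp [bookDepth, orderStat_zero, depth_zero hs]
  | succ k ih =>
    have := depth_sub_depth_orderStat s hk (right_mem_Icc.2 (orderStat_le_succ hs hk))
    rw [bookDepth_succ, ih (by omega)]
    linarith

/-- The revenue from the first `k` blocks of the order book, by the substitution
`σ = depth s y` on each block. -/
theorem sum_integral_bookDepth {s : Fin n → ℝ} (hs : ∀ j, 0 ≤ s j) {g : ℝ → ℝ}
    (hg : Continuous g) {k : ℕ} (hk : k ≤ n) :
    ∑ j ∈ Finset.Icc 1 k, 1 / ((n : ℝ) - ((j : ℝ) - 1)) *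
        ∫ σ in (bookDepth s (j - 1))..(bookDepth s j), g σ =
      ∫ y in (0 : ℝ)..(orderStat s k), g (depth s y) := by
  induction k with
  | zero => simp [orderStat_zero]
  | succ k ih =>
    have hnk : (0 : ℝ) < n - k := sub_pos.2 (by exact_mod_cast hk)
    have hgc : Continuous fun y => g (depth s y) := hg.comp (continuous_depth s)
    rw [Finset.sum_Icc_succ_top (by omega), ih (by omega),
      ← intervalIntegral.integral_add_adjacent_intervals
        (hgc.intervalIntegrable 0 (orderStat s k)) (hgc.intervalIntegrable _ (orderStat s (k + 1)))]
    congr 1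
    have haff : ∫ y in (orderStat s k)..(orderStat s (k + 1)), g (depth s y) =
        ∫ y in (orderStat s k)..(orderStat s (k + 1)),
          g ((n - k) * y + (depth s (orderStat s k) - (n - k) * orderStat s k)) := by
      refine intervalIntegral.integral_congr fun y hy => congrArg g ?_
      rw [uIcc_of_le (orderStat_le_succ hs hk)] at hy
      linarith [depth_sub_depth_orderStat s hk hy]
    rw [haff, intervalIntegral.integral_comp_mul_add _ hnk.ne', Nat.add_sub_cancel,
      bookDepth_succ, bookDepth_eq_depth hs (by omega : k ≤ n), smul_eq_mul, one_div]
    push_cast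
    congr 2 <;> ring

variable {f g : ℝ → ℝ} {M : ℝ} {a : Fin n → ℝ}

/-- The revenue of bank `i`: its `y`-th unit is sold when `depth s y` units have been sold
altogether. -/
theorem mul_lobPrice (hfg : EqOn f g (Icc 0 M)) (hg : Continuous g) (hM : ∑ i, a i ≤ M)
    {s : Fin n → ℝ} (hs : s ∈ admissible a) (i : Fin n) :
    s i * lobPrice f s i = ∫ y in (0 : ℝ)..(s i), g (depth s y) := by
  have hs0 : ∀ j, 0 ≤ s j := fun j => (hs j trivial).1
  rcases (hs0 i).eq_or_lt with h0 | h0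
  · simp [← h0]
  have hrank : rank s i ≤ n := ((Tuple.sort s).symm i).isLt
  have hmem : ∀ k ≤ n, bookDepth s k ∈ Icc 0 M := fun k hk => by
    rw [bookDepth_eq_depth hs0 hk]
    exact ⟨depth_nonneg hs0 (orderStat_nonneg hs0 k),
      (depth_le_sum _ _).trans (sum_mem_Icc_of_mem_admissible hM hs).2⟩
  rw [lobPrice, if_pos h0, ← mul_assoc, mul_one_div_cancel h0.ne', one_mul]
  conv_rhs => rw [← orderStat_rank s i]
  rw [← sum_integral_bookDepth hs0 hg hrank]
  refine Finset.sum_congr rfl fun j hj => ?_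
  have hjn := (Finset.mem_Icc.1 hj).2.trans hrank
  congr 1
  refine intervalIntegral.integral_congr fun σ hσ => hfg ?_
  exact ordConnected_Icc.uIcc_subset (hmem _ (by omega)) (hmem _ hjn) hσ

theorem isEquilibrium_lobPrice_iff {h : Fin n → ℝ} {r q : ℝ} {qbar : Fin n → ℝ}
    (ha : ∀ i, 0 < a i) (hq : 0 < q) (hqbar : ∀ i, q < qbar i) (hM : ∑ i, a i ≤ M)
    (hfg : EqOn f g (Icc 0 M)) (hg : Continuous g) (hanti : StrictAntiOn g (Icc 0 M))
    (hpos : ∀ x ∈ Icc 0 M, 0 < g x) (s : Fin n → ℝ) :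
    IsEquilibrium (lobPrice f) a h r q qbar s ↔
      IsKKT (lower a h q qbar) (upper a h qbar)
        (fun s i => 1 - (1 + r) * g (depth s (s i))) s := by
  -- the depth at `y`, as seen by bank `i` while its own order is not completed
  set P : (Fin n → ℝ) → Fin n → ℝ → ℝ := fun s i y =>
    y + ∑ j ∈ Finset.univ \ {i}, min (s j) y with hP
  have hPc : ∀ s i, Continuous (P s i) := fun s i =>
    continuous_id.add (continuous_finsetSum _ fun j _ => continuous_const.min continuous_id)
  have hPmono : ∀ s i, StrictMono (P s i) := fun s i x y hxy =>
    add_lt_add_of_lt_of_le hxy (Finset.sum_le_sum fun j _ => min_le_min_left _ hxy.le)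
  have hPd : ∀ (s : Fin n → ℝ) (i : Fin n) (x y : ℝ), y ≤ x →
      depth (Function.update s i x) y = P s i y := fun s i x y hyx => by
    rw [depth, Finset.sum_eq_add_sum_sdiff_singleton_of_mem (Finset.mem_univ i)]
    simp only [hP, Function.update_self, min_eq_right hyx]
    congr 1
    refine Finset.sum_congr rfl fun j hj => ?_
    rw [Function.update_of_ne (by simpa using hj)]
  have hmem : ∀ s ∈ admissible a, ∀ i, depth s (s i) ∈ Icc 0 M := fun s hs i =>
    ⟨depth_nonneg (fun j => (hs j trivial).1) (hs i trivial).1,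
      (depth_le_sum _ _).trans (sum_mem_Icc_of_mem_admissible hM hs).2⟩
  have hRP : ∀ (s : Fin n → ℝ) (i : Fin n) (x : ℝ), 0 ≤ x →
      ∫ y in (0 : ℝ)..x, g (depth (Function.update s i x) y) = ∫ y in (0 : ℝ)..x, g (P s i y) := by
    intro s i x hx
    refine intervalIntegral.integral_congr fun y hy => ?_
    rw [uIcc_of_le hx] at hy
    exact congrArg g (hPd s i x y hy.2)
  have hder : ∀ (s : Fin n → ℝ) (i : Fin n) (x : ℝ),
      HasDerivAt (fun x => ∫ y in (0 : ℝ)..x, g (P s i y)) (g (P s i x)) x := fun s i x =>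
    have hc : Continuous fun y => g (P s i y) := hg.comp (hPc s i)
    intervalIntegral.integral_hasDerivAt_right (hc.intervalIntegrable _ _)
      (hc.stronglyMeasurableAtFilter _ _) hc.continuousAt
  refine isEquilibrium_iff_isKKT (m := fun s i => g (depth s (s i)))
    ha hq hqbar (fun s hs i => mul_lobPrice hfg hg hM hs i) ?_ ?_ ?_ ?_ ?_ s
  · intro s hs i
    simp only [Function.update_self]
    exact ContinuousOn.congr (fun x _ => (hder s i x).continuousAt.continuousWithinAt)
      fun x hx => hRP s i x hx.1
  · intro s hs i x hx
    simp only [Function.update_self, hPd s i x x le_rfl]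
    refine (hder s i x).congr_of_eventuallyEq ?_
    filter_upwards [lt_mem_nhds hx.1] with y hy using hRP s i y hy.le
  · exact fun s hs i => hpos _ (hmem s hs i)
  · intro s hs i
    simp only [Function.update_self, hPd s i _ _ le_rfl]
    exact (hg.comp (hPc s i)).continuousOn
  · intro s hs i x hx y hy hxy
    have h1 := hmem _ (update_mem_admissible hs hx) i
    have h2 := hmem _ (update_mem_admissible hs hy) i
    simp only [Function.update_self, hPd s i _ _ le_rfl] at h1 h2 ⊢
    exact hanti h1 h2 (hPmono s i hxy)

end Lob

end

end FireSale

theorem mainTheorem5 {n : ℕ} (a h : Fin n → ℝ) (ha : ∀ i, 0 < a i) (hh : ∀ i, 0 < h i)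
    (r M : ℝ) (hM : ∑ i, a i ≤ M) (f : ℝ → ℝ) (hf : FireSale.IsOrderBookDensity M f)
    (q : ℝ) (qbar : Fin n → ℝ) (hq : 0 < q) (hqbar : ∀ i, q < qbar i ∧ qbar i ≤ 1) :
    (∃! s : Fin n → ℝ, FireSale.IsEquilibrium (FireSale.vwapPrice f) a h r q qbar s) ∧
    (∃! s : Fin n → ℝ, FireSale.IsEquilibrium (FireSale.lobPrice f) a h r q qbar s) := by
  have hM0 : 0 ≤ M := (Finset.sum_nonneg fun i _ => (ha i).le).trans hM
  have hqb : ∀ i, q < qbar i := fun i => (hqbar i).1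
  -- a continuous extension of the density to the whole line
  set g : ℝ → ℝ := Set.IccExtend hM0 (Set.domRestrict (Set.Icc 0 M) f) with hgdef
  have hfg : Set.EqOn f g (Set.Icc 0 M) := fun x hx => by
    rw [hgdef, Set.IccExtend_of_mem hM0 _ hx, Set.domRestrict_apply]
  have hg : Continuous g :=
    (continuousOn_iff_continuous_domRestrict.1 hf.contDiff.continuousOn).Icc_extend'
  have hanti : StrictAntiOn g (Set.Icc 0 M) := hf.strictAnti.congr hfg
  have hpos : ∀ x ∈ Set.Icc 0 M, 0 < g x := fun x hx => hfg hx ▸ (hf.mapsTo hx).1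
  have hg0 : g 0 = 1 := (hfg (Set.left_mem_Icc.2 hM0)).symm.trans hf.zero
  have hl := FireSale.lower_nonneg (h := h) (q := q) (qbar := qbar) ha
  have hlu := FireSale.lower_le_upper (a := a) hh hq hqb
  have hu : ∑ i, FireSale.upper a h qbar i ≤ M :=
    (Finset.sum_le_sum fun i _ => FireSale.upper_le hq hqb i).trans hM
  constructor
  · simp only [FireSale.isEquilibrium_vwapPrice_iff ha hq hqb hM hfg hg hanti hpos]
    obtain ⟨s, hs⟩ := FireSale.exists_isKKT_share (r := r) hg hanti hpos hg0 hl hlu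
      (FireSale.upper_pos ha hh hq hqb) hu
    exact ⟨s, hs, fun t ht => FireSale.isKKT_share_unique hg hanti hpos hl hu ht hs⟩
  · simp only [FireSale.isEquilibrium_lobPrice_iff ha hq hqb hM hfg hg hanti hpos]
    have hcross : FireSale.SingleCrossingOn (fun d => 1 - (1 + r) * g d) (Set.Icc 0 M) :=
      fun x hx y hy hxy => FireSale.one_sub_mul_pos (hpos y hy) (hanti hx hy hxy)
    obtain ⟨s, hs⟩ := FireSale.exists_isKKT_depth (g := fun d => 1 - (1 + r) * g d) hl hlu hu
      (continuous_const.sub (continuous_const.mul hg)).continuousOn hcross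
    exact ⟨s, hs, fun t ht => FireSale.isKKT_depth_unique hl hu hcross ht hs⟩
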